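/- Let $N\ge 2$, $1<p<N$, and let $\Omega\subset\mathbb R^N$ be open and bounded. Let $a:\Omega\times\mathbb R\times\mathbb R^N\to\mathbb R^N$ be a Carathéodory function such that $$a(x,s,\xi)\cdot\xi\ \ge\ b(s)|\xi|^p\qquad\text{for a.e. }x\in\Omega\text{ and all }s\in\mathbb R,\ \xi\in\mathbb R^N,$$ where $b:\mathbb R\to\mathbb R$ is continuous and bounded and, for some $\alpha>0$ and $\gamma_2\ge 0$, $$b(s)\ \ge\ \frac{\alpha}{(1+|s|)^{\theta(p-1)}}\quad\text{for all }s\in\mathbb R,\qquad \theta=1+\frac{\gamma_2}{p-1}.$$ Let $h:[0,\infty)\to[0,\infty]$ be continuous and finite outside the origin and such that, for some $c_2,s_2>0$, $h(s)\le c_2 s^{-\gamma_2}$ for all $s\ge s_2$. Let $f\in L^{N/p}(\Omega)$ be nonnegative. For $k>0$ put $T_k(s)=\max(-k,\min(s,k))$. If $u$ is measurable and $T_k(u)\in W^{1,1}_{\rm loc}(\Omega)$ for every $k>0$, then $\nabla u$ denotes the a.e. unique measurable $v:\Omega\to\mathbb R^N$ with $\nabla T_k(u)=v\chi_{\{|u|\le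 k\}}$ a.e. in $\Omega$ for every $k>0$. A nonnegative, measurable, a.e. finite function $u$ on $\Omega$ is called an entropy solution of $$-\operatorname{div}(a(x,u,\nabla u))=h(u)f\ \text{ in }\Omega,\qquad u\ge 0\ \text{ in }\Omega,\qquad u=0\ \text{ on }\partial\Omega,$$ if $T_k(u)\in W^{1,p}_0(\Omega)$ for every $k>0$, and if for every $k>0$ and every $\varphi\in W^{1,p}_0(\Omega)\cap L^\infty(\Omega)$ one has $a(x,T_k(u),\nabla T_k(u))\in L^{\frac p{p-1}}(\Omega)^N$, $h(u)fT_k(u-\varphi)\in L^1(\Omega)$ (with $\infty\cdot 0=0$) and $$\int_\Omega a(x,u,\nabla u)\cdot\nabla T_k(u-\varphi)\ \le\ \int_\Omega h(u)fT_k(u-\varphi).$$ Then every entropy solution $u$ of this problem belongs to $W^{1,p}_0(\Omega)$ and to $L^q(\Omega)$ for every $q<\infty$. -/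

import Mathlib

open MeasureTheory Filter Topology
open scoped ENNReal ContDiff

namespace EntropyDirichlet

/-- The Euclidean space `ℝ^N`. -/
abbrev E (N : ℕ) : Type := EuclideanSpace ℝ (Fin N)

/-- The truncation `T_k(s) = max (-k) (min s k)`. -/
noncomputable def trunc (k s : ℝ) : ℝ := max (-k) (min s k)

/-- `ψ ∈ C_c^∞(Ω)`. -/
def IsTestFunction {N : ℕ} (Ω : Set (E N)) (ψ : E N → ℝ) : Prop :=
  ContDiff ℝ ∞ ψ ∧ HasCompactSupport ψ ∧ tsupport ψ ⊆ Ω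

/-- `w ∈ L¹_loc(Ω)` has the distributional gradient `G ∈ L¹_loc(Ω)^N` on `Ω`
(so `w ∈ W^{1,1}_loc(Ω)` and `G = ∇w`, which is unique up to null sets). -/
def IsWeakGradient {N : ℕ} (Ω : Set (E N)) (w : E N → ℝ) (G : E N → E N) : Prop :=
  LocallyIntegrableOn w Ω ∧ LocallyIntegrableOn G Ω ∧
    ∀ ψ : E N → ℝ, IsTestFunction Ω ψ → ∀ e : E N,
      ∫ x in Ω, w x * fderiv ℝ ψ x e = -∫ x in Ω, inner ℝ (G x) e * ψ x

/-- `w ∈ W^{1,p}_0(Ω)`, the closure of `C_c^∞(Ω)` in `W^{1,p}(Ω)`: the function `w` and its weak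
gradient `G` are in `L^p(Ω)`, and some sequence of test functions converges to `w` in `L^p(Ω)`
with gradients converging to `G` in `L^p(Ω)`. -/
def MemW0 {N : ℕ} (p : ℝ) (Ω : Set (E N)) (w : E N → ℝ) : Prop :=
  MemLp w (ENNReal.ofReal p) (volume.restrict Ω) ∧
    ∃ G : E N → E N, IsWeakGradient Ω w G ∧
      MemLp G (ENNReal.ofReal p) (volume.restrict Ω) ∧
      ∃ ψ : ℕ → E N → ℝ, (∀ n, IsTestFunction Ω (ψ n)) ∧
        Tendsto (fun n => eLpNorm (fun x => ψ n x - w x) (ENNReal.ofReal p)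
          (volume.restrict Ω)) atTop (𝓝 0) ∧
        Tendsto (fun n => eLpNorm (fun x => gradient (ψ n) x - G x) (ENNReal.ofReal p)
          (volume.restrict Ω)) atTop (𝓝 0)

/-- `v` is the generalized gradient of `u`: it is the (up to null sets unique) measurable function
with `∇ T_k(u) = v χ_{|u| ≤ k}` almost everywhere in `Ω` for every `k > 0`. -/
def IsGenGradient {N : ℕ} (Ω : Set (E N)) (u : E N → ℝ) (v : E N → E N) : Prop :=
  AEMeasurable v (volume.restrict Ω) ∧
    ∀ k : ℝ, 0 < k →
      IsWeakGradient Ω (fun x => trunc k (u x)) ({x | |u x| ≤ k}.indicator v)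

/-- `a : Ω × ℝ × ℝ^N → ℝ^N` is a Carathéodory function. -/
def IsCaratheodory {N : ℕ} (Ω : Set (E N)) (a : E N → ℝ → E N → E N) : Prop :=
  (∀ s ξ, AEMeasurable (fun x => a x s ξ) (volume.restrict Ω)) ∧
    ∀ᵐ x ∂volume.restrict Ω, Continuous fun z : ℝ × E N => a x z.1 z.2

/-- The factor `h(u) f` with values in `[0, ∞]` (with the convention `∞ · 0 = 0`), where `f ≥ 0`
and `h` may be infinite at the origin. -/
noncomputable def source {N : ℕ} (h : ℝ → ℝ≥0∞) (f u : E N → ℝ) (x : E N) : ℝ≥0∞ :=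
  h (u x) * ENNReal.ofReal (f x)

/-- `u` is an entropy solution of `-div a(x, u, ∇u) = h(u) f` in `Ω`, `u ≥ 0` in `Ω`, `u = 0` on
`∂Ω`. Here `v` is the generalized gradient of `u`, and `G` is the weak gradient of the truncation
in question; both are determined up to null sets. -/
structure IsEntropySolution {N : ℕ} (p : ℝ) (Ω : Set (E N)) (a : E N → ℝ → E N → E N)
    (h : ℝ → ℝ≥0∞) (f u : E N → ℝ) : Prop where
  aemeasurable : AEMeasurable u (volume.restrict Ω)
  nonneg : ∀ᵐ x ∂volume.restrict Ω, 0 ≤ u x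
  trunc_mem : ∀ k : ℝ, 0 < k → MemW0 p Ω (fun x => trunc k (u x))
  /-- `a(x, T_k(u), ∇T_k(u)) ∈ L^{p/(p-1)}(Ω)^N`. -/
  flux_memLp : ∀ k : ℝ, 0 < k → ∀ G : E N → E N,
    IsWeakGradient Ω (fun x => trunc k (u x)) G →
      MemLp (fun x => a x (trunc k (u x)) (G x)) (ENNReal.ofReal (p / (p - 1)))
        (volume.restrict Ω)
  /-- `h(u) f T_k(u - φ) ∈ L¹(Ω)`. -/
  source_integrable : ∀ k : ℝ, 0 < k → ∀ φ : E N → ℝ,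
    MemW0 p Ω φ → MemLp φ ⊤ (volume.restrict Ω) →
      ∫⁻ x in Ω, source h f u x * ‖trunc k (u x - φ x)‖ₑ < ⊤
  /-- `∫ a(x, u, ∇u) · ∇T_k(u - φ) ≤ ∫ h(u) f T_k(u - φ)`. -/
  entropy_le : ∀ v : E N → E N, IsGenGradient Ω u v →
    ∀ k : ℝ, 0 < k → ∀ φ : E N → ℝ,
      MemW0 p Ω φ → MemLp φ ⊤ (volume.restrict Ω) →
        ∀ G : E N → E N, IsWeakGradient Ω (fun x => trunc k (u x - φ x)) G →
          ∫ x in Ω, inner ℝ (a x (u x) (v x)) (G x) ≤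
            ∫ x in Ω, (source h f u x).toReal * trunc k (u x - φ x)

end EntropyDirichlet

/-!
Testing the entropy inequality with `φ = T_t(u)`, `k = t` sees only the slice `{t < u ≤ 2t}`, where
the degeneracy `(1 + u)^{-θ(p-1)}` of the operator is compensated by the decay `u^{-γ₂}` of `h`
except for a factor `t^p`: `∫_{t < u ≤ 2t} |∇u|^p ≤ C t^p ∫_{u > t} |f|`. By Hölder's inequality the
right-hand side is at most `C t^p ‖f‖_{L^{N/p}(u > t)} μ(u > t)^{1 - p/N}`, and by Sobolev's
inequality for `T_{2t}(u) - T_t(u)` the left-hand side is at least `c t^p μ(u > 2t)^{1 - p/N}`.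
Hence `μ(u > 2t)^{1 - p/N} ≤ δ(t) μ(u > t)^{1 - p/N}` with `δ(t) → 0`, so along `t = t₀ 2^i` the
measure of `{u > t}` decays faster than any geometric sequence. This gives `u ∈ L^q` for every
`q < ∞`, and the slice energies are summable, so that `∇u ∈ L^p` and `T_k(u) → u` in `W^{1,p}`.
-/

namespace EntropyDirichlet

open scoped NNReal

section Convergence

variable {X F : Type*} [MeasurableSpace X] {μ : Measure X} [NormedAddCommGroup F]
  {p q : ℝ≥0∞}

/-- Convergence of `f n` to `g` in `L^p(μ)`, stated for functions rather than for elements of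
`Lp F p μ`. -/
def TendstoLp (p : ℝ≥0∞) (μ : Measure X) (f : ℕ → X → F) (g : X → F) : Prop :=
  Tendsto (fun n => eLpNorm (fun x => f n x - g x) p μ) atTop (𝓝 0)

namespace TendstoLp

variable {f f' : ℕ → X → F} {g g' : X → F}

lemma of_dominated (hp : p ≠ ⊤) {b : X → ℝ}
    (hf : ∀ n, AEStronglyMeasurable (f n) μ) (hg : AEStronglyMeasurable g μ) (hb : MemLp b p μ)
    (hfb : ∀ n, ∀ᵐ x ∂μ, ‖f n x - g x‖ ≤ b x)
    (hlim : ∀ᵐ x ∂μ, Tendsto (fun n => f n x) atTop (𝓝 (g x))) : TendstoLp p μ f g := by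
  rcases eq_or_ne p 0 with rfl | hp0
  · simp [TendstoLp]
  have hp_pos : 0 < p.toReal := ENNReal.toReal_pos hp0 hp
  have hint : Tendsto (fun n => ∫⁻ x, ‖f n x - g x‖ₑ ^ p.toReal ∂μ) atTop
      (𝓝 (∫⁻ _, 0 ∂μ)) := by
    refine tendsto_lintegral_of_dominated_convergence' (fun x => ‖b x‖ₑ ^ p.toReal)
      (fun n => ((hf n).sub hg).enorm.pow_const _) (fun n => ?_)
      (lintegral_rpow_enorm_lt_top_of_eLpNorm_lt_top hp0 hp hb.2).ne ?_
    · filter_upwards [hfb n] with x hx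
      gcongr
      exact enorm_le_iff_norm_le.2 (hx.trans (le_abs_self _))
    · filter_upwards [hlim] with x hx
      simpa [hp_pos] using (hx.sub_const (g x)).enorm.ennrpow_const p.toReal
  have hroot := hint.ennrpow_const (1 / p.toReal)
  simpa [TendstoLp, eLpNorm_eq_lintegral_rpow_enorm_toReal hp0 hp, hp_pos] using hroot

lemma of_eLpNorm_le {b : ℕ → ℝ≥0∞} (hb : Tendsto b atTop (𝓝 0))
    (h : ∀ n, eLpNorm (fun x => f n x - g x) p μ ≤ b n) : TendstoLp p μ f g :=
  tendsto_of_tendsto_of_tendsto_of_le_of_le tendsto_const_nhds hb (fun _ => zero_le) h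

lemma of_norm_sub_le {F' : Type*} [NormedAddCommGroup F'] {f' : ℕ → X → F'} {g' : X → F'}
    (hf : TendstoLp p μ f g) (C : ℝ)
    (h : ∀ n x, ‖f' n x - g' x‖ ≤ C * ‖f n x - g x‖) : TendstoLp p μ f' g' := by
  refine of_eLpNorm_le ?_ fun n =>
    eLpNorm_le_mul_eLpNorm_of_ae_le_mul (Eventually.of_forall (h n)) p
  simpa using ENNReal.Tendsto.const_mul hf (Or.inr ENNReal.ofReal_ne_top)

lemma congr_right (hf : TendstoLp p μ f g) (hg : g =ᵐ[μ] g') : TendstoLp p μ f g' :=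
  Tendsto.congr (fun _ => eLpNorm_congr_ae (hg.mono fun x hx => by rw [hx])) hf

lemma sub (hp : 1 ≤ p) (hf : TendstoLp p μ f g) (hf' : TendstoLp p μ f' g')
    (hfm : ∀ n, AEStronglyMeasurable (f n) μ) (hgm : AEStronglyMeasurable g μ)
    (hfm' : ∀ n, AEStronglyMeasurable (f' n) μ) (hgm' : AEStronglyMeasurable g' μ) :
    TendstoLp p μ (fun n x => f n x - f' n x) (fun x => g x - g' x) := by
  refine of_eLpNorm_le (by simpa using Tendsto.add hf hf') fun n => ?_
  simpa only [Pi.sub_def, sub_sub_sub_comm] using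
    eLpNorm_sub_le ((hfm n).sub hgm) ((hfm' n).sub hgm') hp

lemma trans (hp : 1 ≤ p) (hsub : TendstoLp p μ (fun n x => f' n x - f n x) 0)
    (hf : TendstoLp p μ f g) (hfm : ∀ n, AEStronglyMeasurable (f n) μ)
    (hfm' : ∀ n, AEStronglyMeasurable (f' n) μ) (hgm : AEStronglyMeasurable g μ) :
    TendstoLp p μ f' g := by
  refine of_eLpNorm_le (by simpa using Tendsto.add hsub hf) fun n => ?_
  simpa only [Pi.add_def, Pi.sub_def, sub_add_sub_cancel] using
    eLpNorm_add_le ((hfm' n).sub (hfm n)) ((hfm n).sub hgm) hp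

lemma bdd_smul_const [NormedSpace ℝ F] (hp : p ≠ ⊤) {η : ℕ → X → ℝ} {η' : X → ℝ} {C : ℝ}
    (hηm : ∀ n, AEStronglyMeasurable (η n) μ) (hη : ∀ n x, ‖η n x‖ ≤ C)
    (hlim : ∀ᵐ x ∂μ, Tendsto (fun n => η n x) atTop (𝓝 (η' x))) (hg : MemLp g p μ) :
    TendstoLp p μ (fun n x => η n x • g x) (fun x => η' x • g x) := by
  have hηm' : AEStronglyMeasurable η' μ := aestronglyMeasurable_of_tendsto_ae _ hηm hlim
  refine of_dominated hp (fun n => (hηm n).smul hg.1) (hηm'.smul hg.1)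
    (hg.norm.const_mul (C + C)) (fun n => ?_) (hlim.mono fun x hx => hx.smul_const _)
  filter_upwards [hlim] with x hx
  have hη' : ‖η' x‖ ≤ C := le_of_tendsto hx.norm (Eventually.of_forall fun n => hη n x)
  rw [← sub_smul, norm_smul]
  gcongr
  exact (norm_sub_le _ _).trans (add_le_add (hη n x) hη')

lemma bdd_smul [NormedSpace ℝ F] (hp1 : 1 ≤ p) (hp : p ≠ ⊤) {η : ℕ → X → ℝ} {η' : X → ℝ}
    {C : ℝ} (hηm : ∀ n, AEStronglyMeasurable (η n) μ) (hη : ∀ n x, ‖η n x‖ ≤ C)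
    (hlim : ∀ᵐ x ∂μ, Tendsto (fun n => η n x) atTop (𝓝 (η' x))) (hf : TendstoLp p μ f g)
    (hfm : ∀ n, AEStronglyMeasurable (f n) μ) (hg : MemLp g p μ) :
    TendstoLp p μ (fun n x => η n x • f n x) (fun x => η' x • g x) := by
  have hηm' : AEStronglyMeasurable η' μ := aestronglyMeasurable_of_tendsto_ae _ hηm hlim
  refine trans hp1 (hf.of_norm_sub_le C fun n x => ?_) (bdd_smul_const hp hηm hη hlim hg)
    (fun n => (hηm n).smul hg.1) (fun n => (hηm n).smul (hfm n)) (hηm'.smul hg.1)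
  rw [Pi.zero_apply, sub_zero, ← smul_sub, norm_smul]
  gcongr
  exact hη n x

lemma exists_seq_tendsto_ae (hp : p ≠ 0) (hf : TendstoLp p μ f g)
    (hfm : ∀ n, AEStronglyMeasurable (f n) μ) (hgm : AEStronglyMeasurable g μ) :
    ∃ ns : ℕ → ℕ, StrictMono ns ∧
      ∀ᵐ x ∂μ, Tendsto (fun i => f (ns i) x) atTop (𝓝 (g x)) :=
  (tendstoInMeasure_of_tendsto_eLpNorm hp hfm hgm hf).exists_seq_tendsto_ae

lemma tendsto_integral_mul [p.HolderConjugate q] {f : ℕ → X → ℝ} {g η : X → ℝ}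
    (hfm : ∀ n, MemLp (f n) p μ) (hgm : MemLp g p μ) (hη : MemLp η q μ)
    (hf : TendstoLp p μ f g) :
    Tendsto (fun n => ∫ x, f n x * η x ∂μ) atTop (𝓝 (∫ x, g x * η x ∂μ)) := by
  refine tendsto_integral_of_L1' _ (hgm.1.mul hη.1)
    (Eventually.of_forall fun n => (hfm n).integrable_mul hη) ?_
  refine tendsto_of_tendsto_of_tendsto_of_le_of_le tendsto_const_nhds
    (h := fun n => eLpNorm (fun x => f n x - g x) p μ * eLpNorm η q μ) ?_
    (fun _ => zero_le) fun n => ?_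
  · simpa using ENNReal.Tendsto.mul_const hf (Or.inr hη.2.ne)
  · simpa [Pi.sub_def, Pi.mul_def, sub_mul] using
      eLpNorm_smul_le_mul_eLpNorm (r := 1) hη.1 ((hfm n).1.sub hgm.1)

end TendstoLp

end Convergence

variable {N : ℕ} {Ω : Set (E N)} {p : ℝ}

lemma gradient_sub {φ ψ : E N → ℝ} (hψ : Differentiable ℝ ψ) (hφ : Differentiable ℝ φ) :
    gradient (fun y => ψ y - φ y) = fun x => gradient ψ x - gradient φ x := by
  ext1 x
  simp only [gradient, fderiv_fun_sub (hψ x) (hφ x), map_sub]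

lemma gradient_comp {F : ℝ → ℝ} {ψ : E N → ℝ} (hF : Differentiable ℝ F)
    (hψ : Differentiable ℝ ψ) : gradient (F ∘ ψ) = fun x => deriv F (ψ x) • gradient ψ x := by
  ext1 x
  rw [gradient, ((hF _).hasDerivAt.comp_hasFDerivAt x (hψ x).hasFDerivAt).fderiv, map_smul,
    gradient]

lemma norm_gradient (ψ : E N → ℝ) (x : E N) : ‖gradient ψ x‖ = ‖fderiv ℝ ψ x‖ :=
  (InnerProductSpace.toDual ℝ (E N)).symm.norm_map _

lemma continuous_gradient {g : E N → ℝ} (hg : ContDiff ℝ 1 g) : Continuous (gradient g) :=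
  (InnerProductSpace.toDual ℝ (E N)).symm.continuous.comp (hg.continuous_fderiv one_ne_zero)

namespace IsTestFunction

variable {ψ φ : E N → ℝ}

lemma contDiff_one (hψ : IsTestFunction Ω ψ) : ContDiff ℝ 1 ψ :=
  hψ.1.of_le (by simp)

lemma differentiable (hψ : IsTestFunction Ω ψ) : Differentiable ℝ ψ :=
  hψ.contDiff_one.differentiable one_ne_zero

lemma sub (hψ : IsTestFunction Ω ψ) (hφ : IsTestFunction Ω φ) :
    IsTestFunction Ω (fun x => ψ x - φ x) :=
  ⟨hψ.1.sub hφ.1, hψ.2.1.sub hφ.2.1,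
    (tsupport_sub _ _).trans (Set.union_subset hψ.2.2 hφ.2.2)⟩

lemma eq_zero_of_notMem (hψ : IsTestFunction Ω ψ) {x : E N} (hx : x ∉ Ω) : ψ x = 0 :=
  image_eq_zero_of_notMem_tsupport fun hx' => hx (hψ.2.2 hx')

lemma fderiv_apply (hψ : IsTestFunction Ω ψ) (e : E N) :
    IsTestFunction Ω (fun x => fderiv ℝ ψ x e) :=
  ⟨(hψ.1.fderiv_right (by simp)).clm_apply contDiff_const, hψ.2.1.fderiv_apply ℝ e,
    (tsupport_fderiv_apply_subset ℝ e).trans hψ.2.2⟩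

lemma memLp (hψ : IsTestFunction Ω ψ) (q : ℝ≥0∞) (μ : Measure (E N))
    [IsFiniteMeasureOnCompacts μ] : MemLp ψ q μ :=
  hψ.1.continuous.memLp_of_hasCompactSupport hψ.2.1

lemma memLp_gradient (hψ : IsTestFunction Ω ψ) (q : ℝ≥0∞) (μ : Measure (E N))
    [IsFiniteMeasureOnCompacts μ] : MemLp (gradient ψ) q μ :=
  (continuous_gradient hψ.contDiff_one).memLp_of_hasCompactSupport
    ((hψ.2.1.fderiv ℝ).comp_left (map_zero (InnerProductSpace.toDual ℝ (E N)).symm))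

lemma support_gradient_subset (hψ : IsTestFunction Ω ψ) : Function.support (gradient ψ) ⊆ Ω := by
  intro x hx
  refine hψ.2.2 (support_fderiv_subset ℝ ?_)
  rwa [Function.mem_support, ← norm_ne_zero_iff, ← norm_gradient, norm_ne_zero_iff]

lemma integrable_mul {g : E N → ℝ} (hψ : IsTestFunction Ω ψ) (hg : LocallyIntegrableOn g Ω) :
    Integrable (fun x => g x * ψ x) (volume.restrict Ω) := by
  refine Integrable.restrict ?_
  rw [← integrableOn_iff_integrable_of_support_subset (s := tsupport ψ) fun x hx =>
    subset_tsupport ψ (right_ne_zero_of_mul hx)]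
  exact (hg.integrableOn_compact_subset hψ.2.2 hψ.2.1).mul_continuousOn
    hψ.1.continuous.continuousOn hψ.2.1

end IsTestFunction

lemma locallyIntegrableOn_inner {G : E N → E N} (hG : LocallyIntegrableOn G Ω) (e : E N) :
    LocallyIntegrableOn (fun x => inner ℝ (G x) e) Ω := fun x hx =>
  let ⟨s, hs, h⟩ := hG x hx
  ⟨s, hs, h.inner_const e⟩

lemma locallyIntegrableOn_of_memLp {F : Type*} [NormedAddCommGroup F] {q : ℝ≥0∞} {w : E N → F}
    (hq : 1 ≤ q) (hw : MemLp w q (volume.restrict Ω)) : LocallyIntegrableOn w Ω :=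
  locallyIntegrableOn_of_locallyIntegrable_restrict (hw.locallyIntegrable hq)

lemma isWeakGradient_of_contDiff (Ω : Set (E N)) {g : E N → ℝ} (hg : ContDiff ℝ 1 g) :
    IsWeakGradient Ω g (gradient g) := by
  have hfc : ∀ e, Continuous fun x => fderiv ℝ g x e := fun e =>
    (hg.continuous_fderiv one_ne_zero).clm_apply continuous_const
  refine ⟨hg.continuous.locallyIntegrable.locallyIntegrableOn _,
    (continuous_gradient hg).locallyIntegrable.locallyIntegrableOn _, fun ψ hψ e => ?_⟩
  have hψ' : IsTestFunction Set.univ ψ := ⟨hψ.1, hψ.2.1, Set.subset_univ _⟩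
  have hint : ∀ {η k : E N → ℝ}, IsTestFunction Set.univ η → Continuous k →
      Integrable fun x => k x * η x := fun hη hk => by
    simpa using hη.integrable_mul (hk.locallyIntegrable.locallyIntegrableOn _)
  rw [setIntegral_eq_integral_of_forall_compl_eq_zero
      fun x hx => by simp [(hψ.fderiv_apply e).eq_zero_of_notMem hx],
    setIntegral_eq_integral_of_forall_compl_eq_zero
      fun x hx => by simp [hψ.eq_zero_of_notMem hx]]
  simp only [inner_gradient_left]
  exact integral_mul_fderiv_eq_neg_fderiv_mul_of_integrable (hint hψ' (hfc e))
    (hint (hψ'.fderiv_apply e) hg.continuous) (hint hψ' hg.continuous)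
    (fun x _ => hg.differentiable one_ne_zero x) (fun x _ => hψ.differentiable x)

namespace IsWeakGradient

variable {w w' : E N → ℝ} {G G' : E N → E N}

lemma sub (h : IsWeakGradient Ω w G) (h' : IsWeakGradient Ω w' G') :
    IsWeakGradient Ω (fun x => w x - w' x) (fun x => G x - G' x) := by
  refine ⟨h.1.sub h'.1, h.2.1.sub h'.2.1, fun ψ hψ e => ?_⟩
  simp only [sub_mul, inner_sub_left]
  rw [integral_sub ((hψ.fderiv_apply e).integrable_mul h.1)
      ((hψ.fderiv_apply e).integrable_mul h'.1),
    integral_sub (hψ.integrable_mul (locallyIntegrableOn_inner h.2.1 e))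
      (hψ.integrable_mul (locallyIntegrableOn_inner h'.2.1 e)),
    h.2.2 ψ hψ e, h'.2.2 ψ hψ e]
  ring

lemma congr (h : IsWeakGradient Ω w G) (hw : w =ᵐ[volume.restrict Ω] w')
    (hG : G =ᵐ[volume.restrict Ω] G') : IsWeakGradient Ω w' G' := by
  refine ⟨(locallyIntegrableOn_congr hw).1 h.1, (locallyIntegrableOn_congr hG).1 h.2.1,
    fun ψ hψ e => ?_⟩
  calc ∫ x in Ω, w' x * fderiv ℝ ψ x e
      = ∫ x in Ω, w x * fderiv ℝ ψ x e := integral_congr_ae (hw.mono fun x hx => by simp only [hx])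
    _ = -∫ x in Ω, inner ℝ (G x) e * ψ x := h.2.2 ψ hψ e
    _ = -∫ x in Ω, inner ℝ (G' x) e * ψ x :=
      congrArg _ (integral_congr_ae (hG.mono fun x hx => by simp only [hx]))

lemma inner_ae_eq_zero (hΩ : IsOpen Ω) (h : IsWeakGradient Ω 0 G) (e : E N) :
    ∀ᵐ x ∂volume.restrict Ω, inner ℝ (G x) e = 0 := by
  rw [ae_restrict_iff' hΩ.measurableSet]
  refine hΩ.ae_eq_zero_of_integral_contDiff_smul_eq_zero (locallyIntegrableOn_inner h.2.1 e)
    fun ψ hψ hψc hψΩ => ?_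
  have hψ' : IsTestFunction Ω ψ := ⟨hψ, hψc, hψΩ⟩
  rw [← setIntegral_eq_integral_of_forall_compl_eq_zero (s := Ω)
    fun x hx => by simp [hψ'.eq_zero_of_notMem hx]]
  simpa [mul_comm] using h.2.2 ψ hψ' e

lemma unique (hΩ : IsOpen Ω) (h : IsWeakGradient Ω w G) (h' : IsWeakGradient Ω w G') :
    G =ᵐ[volume.restrict Ω] G' := by
  have hsub : IsWeakGradient Ω 0 (fun x => G x - G' x) := by
    simpa [Pi.zero_def] using h.sub h'
  have hcoord := ae_all_iff.2 fun i : Fin N =>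
    hsub.inner_ae_eq_zero hΩ (EuclideanSpace.single i (1 : ℝ))
  filter_upwards [hcoord] with x hx
  ext i
  simpa [EuclideanSpace.inner_single_right, sub_eq_zero] using hx i

lemma of_tendsto {q : ℝ≥0∞} (hq : 1 ≤ q) {wn : ℕ → E N → ℝ} {Gn : ℕ → E N → E N}
    (hwn : ∀ n, MemLp (wn n) q (volume.restrict Ω)) (hw : MemLp w q (volume.restrict Ω))
    (hGn : ∀ n, MemLp (Gn n) q (volume.restrict Ω)) (hG : MemLp G q (volume.restrict Ω))
    (h : ∀ n, IsWeakGradient Ω (wn n) (Gn n))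
    (hlim : TendstoLp q (volume.restrict Ω) wn w)
    (hlim' : TendstoLp q (volume.restrict Ω) Gn G) : IsWeakGradient Ω w G := by
  refine ⟨locallyIntegrableOn_of_memLp hq hw, locallyIntegrableOn_of_memLp hq hG,
    fun ψ hψ e => ?_⟩
  have := ENNReal.HolderConjugate.conjExponent hq
  have hleft := hlim.tendsto_integral_mul hwn hw
    ((hψ.fderiv_apply e).memLp q.conjExponent _)
  have hinner : TendstoLp q (volume.restrict Ω) (fun n x => inner ℝ (Gn n x) e)
      (fun x => inner ℝ (G x) e) := hlim'.of_norm_sub_le ‖e‖ fun n x => by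
    rw [← inner_sub_left, mul_comm]
    exact norm_inner_le_norm _ _
  have hright := hinner.tendsto_integral_mul (fun n => (hGn n).inner_const e)
    (hG.inner_const e) (hψ.memLp q.conjExponent _)
  exact tendsto_nhds_unique (hleft.congr fun n => (h n).2.2 ψ hψ e) hright.neg

end IsWeakGradient

/-- `w ∈ W^{1,p}_0(Ω)` with weak gradient `G`: the class `MemW0` with the gradient exposed. -/
structure MemW0With (p : ℝ) (Ω : Set (E N)) (w : E N → ℝ) (G : E N → E N) : Prop where
  memLp : MemLp w (ENNReal.ofReal p) (volume.restrict Ω)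
  isWeakGradient : IsWeakGradient Ω w G
  memLp_gradient : MemLp G (ENNReal.ofReal p) (volume.restrict Ω)
  exists_approx : ∃ ψ : ℕ → E N → ℝ, (∀ n, IsTestFunction Ω (ψ n)) ∧
    TendstoLp (ENNReal.ofReal p) (volume.restrict Ω) ψ w ∧
    TendstoLp (ENNReal.ofReal p) (volume.restrict Ω) (fun n => gradient (ψ n)) G

lemma memW0_iff {w : E N → ℝ} : MemW0 p Ω w ↔ ∃ G, MemW0With p Ω w G :=
  ⟨fun ⟨h, G, hw, hG, hψ⟩ => ⟨G, h, hw, hG, hψ⟩, fun ⟨G, h⟩ => ⟨h.1, G, h.2, h.3, h.4⟩⟩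

namespace MemW0With

variable {w w' : E N → ℝ} {G G' : E N → E N}

lemma congr_gradient (h : MemW0With p Ω w G) (hG : G =ᵐ[volume.restrict Ω] G') :
    MemW0With p Ω w G' :=
  let ⟨ψ, hψ, hlim, hlim'⟩ := h.exists_approx
  ⟨h.memLp, h.isWeakGradient.congr .rfl hG, h.memLp_gradient.ae_eq hG,
    ψ, hψ, hlim, hlim'.congr_right hG⟩

lemma sub (hp : 1 ≤ p) (h : MemW0With p Ω w G) (h' : MemW0With p Ω w' G') :
    MemW0With p Ω (fun x => w x - w' x) (fun x => G x - G' x) := by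
  obtain ⟨ψ, hψ, hlim, hlim'⟩ := h.exists_approx
  obtain ⟨φ, hφ, hlimφ, hlimφ'⟩ := h'.exists_approx
  have hq : 1 ≤ ENNReal.ofReal p := ENNReal.one_le_ofReal.2 hp
  refine ⟨h.memLp.sub h'.memLp, h.isWeakGradient.sub h'.isWeakGradient,
    h.memLp_gradient.sub h'.memLp_gradient, fun n x => ψ n x - φ n x,
    fun n => (hψ n).sub (hφ n), ?_, ?_⟩
  · exact hlim.sub hq hlimφ (fun n => ((hψ n).memLp 0 _).1) h.memLp.1
      (fun n => ((hφ n).memLp 0 _).1) h'.memLp.1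
  · simp only [gradient_sub (hψ _).differentiable (hφ _).differentiable]
    exact hlim'.sub hq hlimφ' (fun n => ((hψ n).memLp_gradient 0 _).1) h.memLp_gradient.1
      (fun n => ((hφ n).memLp_gradient 0 _).1) h'.memLp_gradient.1

lemma exists_approx_ae (hp : 0 < p) (h : MemW0With p Ω w G) :
    ∃ ψ : ℕ → E N → ℝ, (∀ n, IsTestFunction Ω (ψ n)) ∧
      TendstoLp (ENNReal.ofReal p) (volume.restrict Ω) ψ w ∧
      TendstoLp (ENNReal.ofReal p) (volume.restrict Ω) (fun n => gradient (ψ n)) G ∧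
      ∀ᵐ x ∂volume.restrict Ω, Tendsto (fun n => ψ n x) atTop (𝓝 (w x)) := by
  obtain ⟨ψ, hψ, hlim, hlim'⟩ := h.exists_approx
  obtain ⟨ns, hns, hae⟩ := hlim.exists_seq_tendsto_ae (by simpa using hp)
    (fun n => ((hψ n).memLp 0 _).1) h.memLp.1
  exact ⟨fun n => ψ (ns n), fun n => hψ _, hlim.comp hns.tendsto_atTop,
    hlim'.comp hns.tendsto_atTop, hae⟩

/- A diagonal sequence: `wn n` is replaced by a test function at distance at most `1 / n`. -/
lemma of_tendsto (hp : 1 ≤ p) {wn : ℕ → E N → ℝ} {Gn : ℕ → E N → E N}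
    (hw : MemLp w (ENNReal.ofReal p) (volume.restrict Ω))
    (hG : MemLp G (ENNReal.ofReal p) (volume.restrict Ω))
    (h : ∀ n, MemW0With p Ω (wn n) (Gn n))
    (hlim : TendstoLp (ENNReal.ofReal p) (volume.restrict Ω) wn w)
    (hlim' : TendstoLp (ENNReal.ofReal p) (volume.restrict Ω) Gn G) : MemW0With p Ω w G := by
  have hq : 1 ≤ ENNReal.ofReal p := ENNReal.one_le_ofReal.2 hp
  have hweak : IsWeakGradient Ω w G :=
    .of_tendsto hq (fun n => (h n).memLp) hw (fun n => (h n).memLp_gradient) hG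
      (fun n => (h n).isWeakGradient) hlim hlim'
  have happrox : ∀ n : ℕ, ∃ ψ : E N → ℝ, IsTestFunction Ω ψ ∧
      eLpNorm (fun x => ψ x - wn n x) (ENNReal.ofReal p) (volume.restrict Ω) ≤ (n : ℝ≥0∞)⁻¹ ∧
      eLpNorm (fun x => gradient ψ x - Gn n x) (ENNReal.ofReal p) (volume.restrict Ω) ≤
        (n : ℝ≥0∞)⁻¹ := fun n => by
    obtain ⟨ψ, hψ, hψw, hψG⟩ := (h n).exists_approx
    have hn : (0 : ℝ≥0∞) < (n : ℝ≥0∞)⁻¹ := by simp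
    obtain ⟨i, hi, hi'⟩ := ((hψw.eventually_le_const hn).and (hψG.eventually_le_const hn)).exists
    exact ⟨ψ i, hψ i, hi, hi'⟩
  choose ψ hψ hψw hψG using happrox
  have hinv : Tendsto (fun n : ℕ => (n : ℝ≥0∞)⁻¹) atTop (𝓝 0) :=
    ENNReal.tendsto_inv_nat_nhds_zero
  refine ⟨hw, hweak, hG, ψ, hψ, ?_, ?_⟩
  · exact TendstoLp.trans hq (.of_eLpNorm_le hinv (by simpa using hψw)) hlim
      (fun n => (h n).memLp.1) (fun n => ((hψ n).memLp 0 _).1) hw.1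
  · exact TendstoLp.trans hq (.of_eLpNorm_le hinv (by simpa using hψG)) hlim'
      (fun n => (h n).memLp_gradient.1) (fun n => ((hψ n).memLp_gradient 0 _).1) hG.1

lemma isWeakGradient_comp (hp : 1 ≤ p) (h : MemW0With p Ω w G) {F : ℝ → ℝ}
    (hF : ContDiff ℝ 1 F) (hF0 : F 0 = 0) {C : ℝ≥0} (hC : ∀ t, ‖deriv F t‖₊ ≤ C) :
    IsWeakGradient Ω (fun x => F (w x)) (fun x => deriv F (w x) • G x) := by
  obtain ⟨ψ, hψ, hlim, hlim', hae⟩ := h.exists_approx_ae (by linarith)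
  have hq : 1 ≤ ENNReal.ofReal p := ENNReal.one_le_ofReal.2 hp
  have hdiff : Differentiable ℝ F := hF.differentiable one_ne_zero
  have hlip : LipschitzWith C F := lipschitzWith_of_nnnorm_deriv_le hdiff hC
  have hderiv : Continuous (deriv F) := hF.continuous_deriv le_rfl
  have hF' : ∀ {g : E N → ℝ}, AEStronglyMeasurable g (volume.restrict Ω) →
      AEStronglyMeasurable (fun x => deriv F (g x)) (volume.restrict Ω) :=
    hderiv.comp_aestronglyMeasurable
  have hsmul : ∀ {g : E N → ℝ} {H : E N → E N}, AEStronglyMeasurable g (volume.restrict Ω) →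
      MemLp H (ENNReal.ofReal p) (volume.restrict Ω) →
      MemLp (fun x => deriv F (g x) • H x) (ENNReal.ofReal p) (volume.restrict Ω) :=
    fun hg hH => hH.smul (memLp_top_of_bound (hF' hg) C (Eventually.of_forall fun x => hC _))
  have hψm : ∀ n, AEStronglyMeasurable (ψ n) (volume.restrict Ω) := fun n => ((hψ n).memLp 0 _).1
  refine .of_tendsto hq (wn := fun n x => F (ψ n x))
    (Gn := fun n x => deriv F (ψ n x) • gradient (ψ n) x)
    (fun n => hlip.comp_memLp hF0 ((hψ n).memLp _ _)) (hlip.comp_memLp hF0 h.memLp)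
    (fun n => hsmul (hψm n) ((hψ n).memLp_gradient _ _)) (hsmul h.memLp.1 h.memLp_gradient)
    (fun n => ?_) (hlim.of_norm_sub_le C fun n x => hlip.norm_sub_le _ _) ?_
  · rw [← gradient_comp hdiff (hψ n).differentiable]
    exact isWeakGradient_of_contDiff Ω (hF.comp (hψ n).contDiff_one)
  · exact TendstoLp.bdd_smul hq ENNReal.ofReal_ne_top (fun n => hF' (hψm n)) (fun n x => hC _)
      (hae.mono fun x hx => (hderiv.tendsto _).comp hx) hlim'
      (fun n => ((hψ n).memLp_gradient 0 _).1) h.memLp_gradient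

end MemW0With

lemma contDiff_one_primitive {g : ℝ → ℝ} (hg : Continuous g) :
    ContDiff ℝ 1 fun s => ∫ t in (0)..s, g t := by
  have hderiv : deriv (fun s => ∫ t in (0)..s, g t) = g := funext (hg.deriv_integral _ 0)
  exact contDiff_one_iff_deriv.2
    ⟨fun s => (hg.integral_hasStrictDerivAt 0 s).hasDerivAt.differentiableAt, hderiv.symm ▸ hg⟩

lemma tendsto_primitive {g : ℕ → ℝ → ℝ} {g' : ℝ → ℝ} {C : ℝ} (hg : ∀ n, Continuous (g n))
    (hC : ∀ n t, ‖g n t‖ ≤ C) (hlim : ∀ t, Tendsto (fun n => g n t) atTop (𝓝 (g' t))) (s : ℝ) :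
    Tendsto (fun n => ∫ t in (0)..s, g n t) atTop (𝓝 (∫ t in (0)..s, g' t)) :=
  intervalIntegral.tendsto_integral_filter_of_dominated_convergence (fun _ => C)
    (Eventually.of_forall fun n => (hg n).aestronglyMeasurable)
    (Eventually.of_forall fun n => Eventually.of_forall fun t _ => hC n t)
    intervalIntegrable_const (Eventually.of_forall fun t _ => hlim t)

lemma MemW0With.isWeakGradient_primitive (hp : 1 ≤ p) {w : E N → ℝ} {G : E N → E N}
    (h : MemW0With p Ω w G) {g : ℕ → ℝ → ℝ} {g' : ℝ → ℝ} {C : ℝ≥0} (hg : ∀ n, Continuous (g n))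
    (hC : ∀ n t, ‖g n t‖₊ ≤ C) (hlim : ∀ t, Tendsto (fun n => g n t) atTop (𝓝 (g' t))) :
    IsWeakGradient Ω (fun x => ∫ t in (0)..w x, g' t) (fun x => g' (w x) • G x) := by
  have hC' : ∀ t, ‖g' t‖₊ ≤ C := fun t =>
    le_of_tendsto (hlim t).nnnorm (Eventually.of_forall fun n => hC n t)
  have hprim_lim := tendsto_primitive hg hC hlim
  have hprim_le : ∀ {f : ℝ → ℝ}, (∀ t, ‖f t‖₊ ≤ C) → ∀ s, ‖∫ t in (0)..s, f t‖ ≤ C * ‖s‖ :=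
    fun hf s => by
      simpa using intervalIntegral.norm_integral_le_of_norm_le_const (a := 0) (b := s)
        fun t _ => hf t
  have hm : ∀ n, AEStronglyMeasurable (fun x => ∫ t in (0)..w x, g n t) (volume.restrict Ω) :=
    fun n => (contDiff_one_primitive (hg n)).continuous.comp_aestronglyMeasurable h.memLp.1
  have hgm : ∀ n, AEStronglyMeasurable (fun x => g n (w x)) (volume.restrict Ω) := fun n =>
    (hg n).comp_aestronglyMeasurable h.memLp.1
  have hm' := aestronglyMeasurable_of_tendsto_ae _ hm (Eventually.of_forall fun x => hprim_lim _)
  have hgm' := aestronglyMeasurable_of_tendsto_ae _ hgm (Eventually.of_forall fun x => hlim (w x))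
  have hsmul : ∀ {f : ℝ → ℝ}, AEStronglyMeasurable (fun x => f (w x)) (volume.restrict Ω) →
      (∀ t, ‖f t‖₊ ≤ C) →
      MemLp (fun x => f (w x) • G x) (ENNReal.ofReal p) (volume.restrict Ω) := fun hfm hf =>
    h.memLp_gradient.smul (memLp_top_of_bound hfm C (Eventually.of_forall fun x => hf _))
  refine .of_tendsto (ENNReal.one_le_ofReal.2 hp) (wn := fun n x => ∫ t in (0)..w x, g n t)
    (Gn := fun n x => g n (w x) • G x)
    (fun n => h.memLp.of_le_mul (hm n) (Eventually.of_forall fun x => hprim_le (hC n) _))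
    (h.memLp.of_le_mul hm' (Eventually.of_forall fun x => hprim_le hC' _))
    (fun n => hsmul (hgm n) (hC n)) (hsmul hgm' hC') (fun n => ?_) ?_ ?_
  · have hderiv := (hg n).deriv_integral (g n) 0
    simpa only [hderiv] using h.isWeakGradient_comp hp (contDiff_one_primitive (hg n)) (by simp)
      fun t => by simpa only [hderiv] using hC n t
  · refine .of_dominated ENNReal.ofReal_ne_top hm hm' (h.memLp.norm.const_mul (C + C))
      (fun n => Eventually.of_forall fun x => ?_) (Eventually.of_forall fun x => hprim_lim _)
    exact (norm_sub_le _ _).trans <|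
      (add_le_add (hprim_le (hC n) _) (hprim_le hC' _)).trans_eq (add_mul _ _ _).symm
  · exact .bdd_smul_const ENNReal.ofReal_ne_top hgm (fun n x => hC n _)
      (Eventually.of_forall fun x => hlim (w x)) h.memLp_gradient

section Trunc

variable {k m s t : ℝ}

lemma continuous_trunc (k : ℝ) : Continuous (trunc k) := by
  unfold trunc
  fun_prop

lemma abs_trunc_le (hk : 0 ≤ k) (s : ℝ) : |trunc k s| ≤ k :=
  abs_le.2 ⟨le_max_left _ _, max_le (by linarith) (min_le_right _ _)⟩

lemma trunc_of_abs_le (h : |s| ≤ k) : trunc k s = s := by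
  rw [trunc, min_eq_left (abs_le.1 h).2, max_eq_right (abs_le.1 h).1]

lemma abs_trunc_le_abs (hk : 0 ≤ k) (s : ℝ) : |trunc k s| ≤ |s| := by
  simp only [trunc]
  grind

lemma trunc_trunc (hk : 0 ≤ k) (hkm : k ≤ m) (s : ℝ) : trunc k (trunc m s) = trunc k s := by
  simp only [trunc]
  grind

lemma trunc_sub_trunc (ht : 0 ≤ t) (s : ℝ) :
    trunc t (s - trunc t s) = trunc (2 * t) s - trunc t s := by
  simp only [trunc]
  grind

lemma abs_trunc_le_iff (hkm : k < m) : |trunc m s| ≤ k ↔ |s| ≤ k := by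
  simp only [trunc]
  grind

lemma hasDerivAt_trunc (hk : 0 < k) (hs : s ≠ -k) (hs' : s ≠ k) :
    HasDerivAt (trunc k) ((Set.Icc (-k) k).indicator 1 s) s := by
  rcases lt_or_gt_of_ne hs with h | h
  · rw [Set.indicator_of_notMem fun hmem => h.not_ge hmem.1]
    refine (hasDerivAt_const s (-k)).congr_of_eventuallyEq ?_
    filter_upwards [eventually_lt_nhds h] with y hy
    exact max_eq_left ((min_le_left _ _).trans hy.le)
  rcases lt_or_gt_of_ne hs' with h' | h'
  · rw [Set.indicator_of_mem (Set.mem_Icc.2 ⟨h.le, h'.le⟩)]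
    refine (hasDerivAt_id s).congr_of_eventuallyEq ?_
    filter_upwards [eventually_gt_nhds h, eventually_lt_nhds h'] with y hy hy'
    exact trunc_of_abs_le (abs_le.2 ⟨hy.le, hy'.le⟩)
  · rw [Set.indicator_of_notMem fun hmem => h'.not_ge hmem.2]
    refine (hasDerivAt_const s k).congr_of_eventuallyEq ?_
    filter_upwards [eventually_gt_nhds h'] with y hy
    rw [trunc, min_eq_right hy.le, max_eq_right (by linarith)]

lemma trunc_eq_integral (hk : 0 < k) (s : ℝ) :
    trunc k s = ∫ t in (0)..s, (Set.Icc (-k) k).indicator 1 t := by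
  have hftc := integral_eq_of_hasDerivAt_off_countable (a := 0) (b := s) (trunc k)
    ((Set.Icc (-k) k).indicator 1) (Set.toFinite {-k, k}).countable
    (continuous_trunc k).continuousOn
    (fun t ht => hasDerivAt_trunc hk (fun h => ht.2 (by simp [h])) fun h => ht.2 (by simp [h]))
    (intervalIntegrable_iff.2 ((integrableOn_const (by simp) (by simp)).indicator
      measurableSet_Icc))
  rw [hftc, trunc_of_abs_le (s := 0) (by simpa using hk.le), sub_zero]

end Trunc

lemma MemW0With.isWeakGradient_trunc (hp : 1 ≤ p) {w : E N → ℝ} {G : E N → E N}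
    (h : MemW0With p Ω w G) {k : ℝ} (hk : 0 < k) :
    IsWeakGradient Ω (fun x => trunc k (w x)) ({x | |w x| ≤ k}.indicator G) := by
  have hpos : ∀ n : ℕ, (0 : ℝ) < 1 / (n + 1) := fun n => Nat.one_div_pos_of_nat
  have hlim := tendsto_pi_nhds.1 (thickenedIndicator_tendsto_indicator_closure hpos
    tendsto_one_div_add_atTop_nhds_zero_nat (Set.Icc (-k) k))
  have hcont : ∀ n, Continuous fun t =>
      (thickenedIndicator (hpos n) (Set.Icc (-k) k) t : ℝ) := fun n => by fun_prop
  have hlim' : ∀ t, Tendsto (fun n => (thickenedIndicator (hpos n) (Set.Icc (-k) k) t : ℝ)) atTop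
      (𝓝 ((Set.Icc (-k) k).indicator 1 t)) := fun t => by
    simpa [Set.indicator_apply, apply_ite, Function.comp_def] using
      (NNReal.continuous_coe.tendsto _).comp (hlim t)
  have hprim := h.isWeakGradient_primitive hp (C := 1) hcont
    (fun n t => by simpa using thickenedIndicator_le_one (hpos n) _ t) hlim'
  simp only [← trunc_eq_integral hk] at hprim
  convert hprim using 2 with x
  simp [Set.indicator_apply, abs_le]

lemma IsTestFunction.eLpNorm_le_gradient {ψ : E N → ℝ} (hψ : IsTestFunction Ω ψ) {q : ℝ}
    (hp : 1 ≤ p) (hN : 0 < N) (hq : 0 < q) (hpq : q⁻¹ = p⁻¹ - (N : ℝ)⁻¹) :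
    eLpNorm ψ (ENNReal.ofReal q) (volume.restrict Ω) ≤
      SNormLESNormFDerivOfEqConst ℝ (volume : Measure (E N)) p.toNNReal *
        eLpNorm (gradient ψ) (ENNReal.ofReal p) (volume.restrict Ω) := by
  have hdim : Module.finrank ℝ (E N) = N := finrank_euclideanSpace_fin
  rw [eLpNorm_restrict_eq_of_support_subset hψ.support_gradient_subset,
    eLpNorm_congr_norm_ae (Eventually.of_forall (norm_gradient ψ))]
  refine (eLpNorm_mono_measure ψ Measure.restrict_le_self).trans ?_
  refine eLpNorm_le_eLpNorm_fderiv_of_eq (F := ℝ) volume (p' := q.toNNReal) hψ.contDiff_one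
    hψ.2.1 (by simpa using hp) (by rwa [hdim]) ?_
  rw [hdim, NNReal.coe_inv, Real.coe_toNNReal _ hq.le, Real.coe_toNNReal _ (by linarith), hpq]

lemma MemW0With.eLpNorm_le_gradient {w : E N → ℝ} {G : E N → E N} (h : MemW0With p Ω w G) {q : ℝ}
    (hp : 1 ≤ p) (hN : 0 < N) (hq : 0 < q) (hpq : q⁻¹ = p⁻¹ - (N : ℝ)⁻¹) :
    eLpNorm w (ENNReal.ofReal q) (volume.restrict Ω) ≤
      SNormLESNormFDerivOfEqConst ℝ (volume : Measure (E N)) p.toNNReal *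
        eLpNorm G (ENNReal.ofReal p) (volume.restrict Ω) := by
  obtain ⟨ψ, hψ, -, hlim', hae⟩ := h.exists_approx_ae (by linarith)
  set S : ℝ≥0 := SNormLESNormFDerivOfEqConst ℝ (volume : Measure (E N)) p.toNNReal
  have hbound : ∀ n, eLpNorm (ψ n) (ENNReal.ofReal q) (volume.restrict Ω) ≤
      S * (eLpNorm (fun x => gradient (ψ n) x - G x) (ENNReal.ofReal p) (volume.restrict Ω) +
        eLpNorm G (ENNReal.ofReal p) (volume.restrict Ω)) := fun n => by
    refine ((hψ n).eLpNorm_le_gradient hp hN hq hpq).trans ?_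
    gcongr
    simpa [Pi.add_def, Pi.sub_def] using eLpNorm_add_le
      (((hψ n).memLp_gradient 0 _).1.sub h.memLp_gradient.1) h.memLp_gradient.1
      (ENNReal.one_le_ofReal.2 hp)
  have hlim : Tendsto (fun n => S * (eLpNorm (fun x => gradient (ψ n) x - G x) (ENNReal.ofReal p)
      (volume.restrict Ω) + eLpNorm G (ENNReal.ofReal p) (volume.restrict Ω))) atTop
      (𝓝 (S * (0 + eLpNorm G (ENNReal.ofReal p) (volume.restrict Ω)))) :=
    ENNReal.Tendsto.const_mul (hlim'.add tendsto_const_nhds) (Or.inr ENNReal.coe_ne_top)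
  rw [zero_add] at hlim
  calc eLpNorm w (ENNReal.ofReal q) (volume.restrict Ω)
      ≤ liminf (fun n => eLpNorm (ψ n) (ENNReal.ofReal q) (volume.restrict Ω)) atTop :=
        Lp.eLpNorm_lim_le_liminf_eLpNorm (fun n => ((hψ n).memLp 0 _).1) _ hae
    _ ≤ _ := (liminf_le_liminf (Eventually.of_forall hbound)).trans_eq hlim.liminf_eq

lemma tendsto_trunc_atTop (s : ℝ) : Tendsto (fun k => trunc k s) atTop (𝓝 s) :=
  tendsto_const_nhds.congr' <|
    (eventually_ge_atTop |s|).mono fun _ hk => (trunc_of_abs_le hk).symm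

lemma tendsto_indicator_sublevel_atTop {X F : Type*} [TopologicalSpace F] [Zero F] (u : X → ℝ)
    (v : X → F) (x : X) :
    Tendsto (fun k => {y | |u y| ≤ k}.indicator v x) atTop (𝓝 (v x)) :=
  tendsto_const_nhds.congr' <| (eventually_ge_atTop |u x|).mono fun k hk =>
    (Set.indicator_of_mem (s := {y | |u y| ≤ k}) hk v).symm

lemma tendsto_natCast_add_one_atTop : Tendsto (fun n : ℕ => (n : ℝ) + 1) atTop atTop :=
  tendsto_atTop_add_const_right _ _ tendsto_natCast_atTop_atTop

/-- The slice `{t < |u| ≤ 2t}`. -/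
def dyadicSlice {X : Type*} (u : X → ℝ) (t : ℝ) : Set X :=
  {x | t < |u x| ∧ |u x| ≤ 2 * t}

/-- The class of Bénilan et al. of functions `u` all of whose truncations are in `W^{1,p}_0(Ω)`,
with `v` as generalized gradient. -/
def MemTruncW0 (p : ℝ) (Ω : Set (E N)) (u : E N → ℝ) (v : E N → E N) : Prop :=
  ∀ k : ℝ, 0 < k → MemW0With p Ω (fun x => trunc k (u x)) ({x | |u x| ≤ k}.indicator v)

lemma MemW0With.gradient_trunc_ae_eq (hp : 1 ≤ p) (hΩ : IsOpen Ω) {u : E N → ℝ}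
    {G G' : E N → E N} {k m : ℝ} (hk : 0 < k) (hkm : k < m)
    (h : MemW0With p Ω (fun x => trunc k (u x)) G)
    (h' : MemW0With p Ω (fun x => trunc m (u x)) G') :
    G =ᵐ[volume.restrict Ω] {x | |u x| ≤ k}.indicator G' := by
  refine h.isWeakGradient.unique hΩ ?_
  simpa only [trunc_trunc hk.le hkm.le, abs_trunc_le_iff hkm] using h'.isWeakGradient_trunc hp hk

lemma exists_memTruncW0 (hp : 1 ≤ p) (hΩ : IsOpen Ω) {u : E N → ℝ}
    (hu : ∀ k : ℝ, 0 < k → MemW0 p Ω (fun x => trunc k (u x))) : ∃ v, MemTruncW0 p Ω u v := by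
  have hpos : ∀ n : ℕ, (0 : ℝ) < n + 1 := fun n => n.cast_add_one_pos
  choose G hG using fun n : ℕ => memW0_iff.1 (hu (n + 1) (hpos n))
  refine ⟨fun x => G ⌊|u x|⌋₊ x, fun k hk => ?_⟩
  obtain ⟨Gk, hGk⟩ := memW0_iff.1 (hu k hk)
  have hcons : ∀ᵐ x ∂volume.restrict Ω, ∀ n m : ℕ, n < m →
      G n x = {x | |u x| ≤ n + 1}.indicator (G m) x := by
    simp only [ae_all_iff]
    exact fun n m hnm => (hG n).gradient_trunc_ae_eq hp hΩ (hpos n) (by gcongr) (hG m)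
  have hconsk : ∀ᵐ x ∂volume.restrict Ω, ∀ m : ℕ, k < m + 1 →
      Gk x = {x | |u x| ≤ k}.indicator (G m) x := by
    simp only [ae_all_iff]
    exact fun m hkm => hGk.gradient_trunc_ae_eq hp hΩ hk hkm (hG m)
  refine hGk.congr_gradient ?_
  filter_upwards [hcons, hconsk] with x hx hxk
  obtain ⟨m, hm⟩ := exists_nat_gt (max k ⌊|u x|⌋₊)
  have hkm : k < m + 1 := ((le_max_left _ _).trans_lt hm).trans (lt_add_one _)
  have hnm : ⌊|u x|⌋₊ < m := Nat.cast_lt.1 ((le_max_right _ _).trans_lt hm)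
  have hu_le : |u x| ≤ ⌊|u x|⌋₊ + 1 := (Nat.lt_floor_add_one _).le
  rw [hxk m hkm]
  by_cases hxm : |u x| ≤ k
  · simp [hxm, hx _ m hnm, hu_le]
  · simp [hxm]

namespace MemTruncW0

variable {u : E N → ℝ} {v : E N → E N}

lemma aemeasurable (h : MemTruncW0 p Ω u v) : AEMeasurable u (volume.restrict Ω) :=
  aemeasurable_of_tendsto_metrizable_ae' (f := fun (n : ℕ) x => trunc (n + 1) (u x))
    (fun n => (h _ n.cast_add_one_pos).memLp.1.aemeasurable) <| Eventually.of_forall fun x =>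
      (tendsto_trunc_atTop (u x)).comp tendsto_natCast_add_one_atTop

lemma aestronglyMeasurable_gradient (h : MemTruncW0 p Ω u v) :
    AEStronglyMeasurable v (volume.restrict Ω) :=
  aestronglyMeasurable_of_tendsto_ae atTop (f := fun n : ℕ => {x | |u x| ≤ n + 1}.indicator v)
    (fun n => (h _ n.cast_add_one_pos).memLp_gradient.1) <| Eventually.of_forall fun x =>
      (tendsto_indicator_sublevel_atTop u v x).comp tendsto_natCast_add_one_atTop

lemma isGenGradient (h : MemTruncW0 p Ω u v) : IsGenGradient Ω u v :=
  ⟨h.aestronglyMeasurable_gradient.aemeasurable, fun k hk => (h k hk).isWeakGradient⟩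

lemma nullMeasurableSet_superlevel (h : MemTruncW0 p Ω u v) (t : ℝ) :
    NullMeasurableSet {x | t < |u x|} (volume.restrict Ω) :=
  nullMeasurableSet_lt aemeasurable_const h.aemeasurable.abs

lemma nullMeasurableSet_dyadicSlice (h : MemTruncW0 p Ω u v) (t : ℝ) :
    NullMeasurableSet (dyadicSlice u t) (volume.restrict Ω) :=
  (h.nullMeasurableSet_superlevel t).inter
    (nullMeasurableSet_le h.aemeasurable.abs aemeasurable_const)

lemma memW0With_dyadicSlice (hp : 1 ≤ p) (h : MemTruncW0 p Ω u v) {t : ℝ} (ht : 0 < t) :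
    MemW0With p Ω (fun x => trunc (2 * t) (u x) - trunc t (u x))
      ((dyadicSlice u t).indicator v) := by
  refine ((h (2 * t) (by positivity)).sub hp (h t ht)).congr_gradient
    (Eventually.of_forall fun x => ?_)
  simp only [dyadicSlice, Set.indicator_apply, Set.mem_ofPred_eq]
  grind

lemma memW0 (hp : 1 ≤ p) (h : MemTruncW0 p Ω u v)
    (hu : MemLp u (ENNReal.ofReal p) (volume.restrict Ω))
    (hv : MemLp v (ENNReal.ofReal p) (volume.restrict Ω)) : MemW0 p Ω u := by
  have hpos : ∀ n : ℕ, (0 : ℝ) < n + 1 := fun n => n.cast_add_one_pos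
  refine memW0_iff.2 ⟨v, .of_tendsto hp (wn := fun n x => trunc (n + 1) (u x)) hu hv
    (fun n => h _ (hpos n)) ?_ ?_⟩
  · refine .of_dominated ENNReal.ofReal_ne_top (fun n => (h _ (hpos n)).memLp.1) hu.1
      (hu.norm.add hu.norm) (fun n => Eventually.of_forall fun x => ?_)
      (Eventually.of_forall fun x =>
        (tendsto_trunc_atTop (u x)).comp tendsto_natCast_add_one_atTop)
    exact (norm_sub_le _ _).trans (add_le_add_left (abs_trunc_le_abs (hpos n).le _) _)
  · refine .of_dominated ENNReal.ofReal_ne_top (fun n => (h _ (hpos n)).memLp_gradient.1) hv.1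
      (hv.norm.add hv.norm) (fun n => Eventually.of_forall fun x => ?_)
      (Eventually.of_forall fun x =>
        (tendsto_indicator_sublevel_atTop u v x).comp tendsto_natCast_add_one_atTop)
    exact (norm_sub_le _ _).trans (add_le_add_left (norm_indicator_le_norm_self _ _) _)

end MemTruncW0

namespace IsEntropySolution

variable {a : E N → ℝ → E N → E N} {h : ℝ → ℝ≥0∞} {f u : E N → ℝ} {v : E N → E N} {t : ℝ}

lemma integrable_flux (hu : IsEntropySolution p Ω a h f u) (hv : MemTruncW0 p Ω u v)
    (hp : 1 < p) (ht : 0 < t) :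
    Integrable (fun x => inner ℝ (a x (u x) (v x)) ((dyadicSlice u t).indicator v x))
      (volume.restrict Ω) := by
  have hflux := hu.flux_memLp (2 * t) (by positivity) _ (hv (2 * t) (by positivity)).isWeakGradient
  have hslice := (hv.memW0With_dyadicSlice hp.le ht).memLp_gradient
  have : ENNReal.HolderTriple (ENNReal.ofReal (p / (p - 1))) (ENNReal.ofReal p) 1 :=
    (Real.HolderConjugate.conjExponent hp).symm.ennrealOfReal
  refine ((hflux.norm.integrable_mul hslice.norm).mono' (hflux.1.inner hslice.1)
    (Eventually.of_forall fun x => norm_inner_le_norm _ _)).congr (Eventually.of_forall fun x => ?_)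
  by_cases hx : x ∈ dyadicSlice u t
  · simp [hx, trunc_of_abs_le hx.2, hx.2]
  · simp [hx]

lemma le_ofReal_integral_flux (hu : IsEntropySolution p Ω a h f u) (hv : MemTruncW0 p Ω u v)
    (hp : 1 < p) {α γ : ℝ} (hα : 0 < α) (hγ : 0 ≤ γ)
    (hcoer : ∀ᵐ x ∂volume.restrict Ω, ∀ (s : ℝ) (ξ : E N),
      α / (1 + |s|) ^ (p - 1 + γ) * ‖ξ‖ ^ p ≤ inner ℝ (a x s ξ) ξ) (ht : 1 ≤ t) :
    ENNReal.ofReal (α / (3 * t) ^ (p - 1 + γ)) *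
        ∫⁻ x in dyadicSlice u t, ‖v x‖ₑ ^ p ∂volume.restrict Ω ≤
      ENNReal.ofReal (∫ x in Ω, inner ℝ (a x (u x) (v x)) ((dyadicSlice u t).indicator v x)) := by
  have hp0 : 0 < p := by linarith
  have : 0 ≤ p - 1 + γ := by linarith
  have hpt : ∀ᵐ x ∂volume.restrict Ω,
      (dyadicSlice u t).indicator (fun x => α / (3 * t) ^ (p - 1 + γ) * ‖v x‖ ^ p) x ≤
        inner ℝ (a x (u x) (v x)) ((dyadicSlice u t).indicator v x) := by
    filter_upwards [hcoer] with x hx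
    by_cases hxs : x ∈ dyadicSlice u t
    · simp only [Set.indicator_of_mem hxs]
      refine le_trans ?_ (hx (u x) (v x))
      gcongr
      linarith [hxs.2]
    · simp [hxs]
  have hnonneg : ∀ x, 0 ≤
      (dyadicSlice u t).indicator (fun x => α / (3 * t) ^ (p - 1 + γ) * ‖v x‖ ^ p) x :=
    Set.indicator_nonneg fun x _ => by positivity
  rw [ofReal_integral_eq_lintegral_ofReal (hu.integrable_flux hv hp (by linarith))
      (hpt.mono fun x hx => (hnonneg x).trans hx),
    ← lintegral_const_mul' _ _ ENNReal.ofReal_ne_top,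
    ← lintegral_indicator₀ (hv.nullMeasurableSet_dyadicSlice t)]
  refine lintegral_mono_ae (hpt.mono fun x hx => (le_of_eq ?_).trans (ENNReal.ofReal_le_ofReal hx))
  by_cases hxs : x ∈ dyadicSlice u t
  · rw [Set.indicator_of_mem hxs, Set.indicator_of_mem hxs, ENNReal.ofReal_mul (by positivity),
      ← ENNReal.ofReal_rpow_of_nonneg (norm_nonneg _) hp0.le, ofReal_norm]
  · simp [hxs]

lemma ofReal_integral_source_le (hu : IsEntropySolution p Ω a h f u) {γ c s₀ : ℝ} (hγ : 0 ≤ γ)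
    (hc : 0 ≤ c) (hh : ∀ s, s₀ ≤ s → h s ≤ ENNReal.ofReal (c / s ^ γ)) (ht : 0 < t)
    (hts : s₀ ≤ t) :
    ENNReal.ofReal (∫ x in Ω, (source h f u x).toReal * trunc t (u x - trunc t (u x))) ≤
      ENNReal.ofReal (c / t ^ γ * t) *
        ∫⁻ x in {x | t < |u x|}, ‖f x‖ₑ ∂volume.restrict Ω := by
  have hset : NullMeasurableSet {x | t < |u x|} (volume.restrict Ω) :=
    nullMeasurableSet_lt aemeasurable_const hu.aemeasurable.abs
  refine (Real.ofReal_le_enorm _).trans ((enorm_integral_le_lintegral_enorm _).trans ?_)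
  rw [← lintegral_const_mul' _ _ ENNReal.ofReal_ne_top, ← lintegral_indicator₀ hset]
  refine lintegral_mono_ae (hu.nonneg.mono fun x hux => ?_)
  by_cases hxs : t < |u x|
  · have htu : t ≤ u x := (abs_of_nonneg hux ▸ hxs).le
    have hsource : source h f u x ≤ ENNReal.ofReal (c / t ^ γ) * ‖f x‖ₑ :=
      mul_le_mul' ((hh _ (hts.trans htu)).trans (ENNReal.ofReal_le_ofReal (by gcongr)))
        (Real.ofReal_le_enorm _)
    have htrunc : ‖trunc t (u x - trunc t (u x))‖ₑ ≤ ENNReal.ofReal t := by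
      rw [Real.enorm_eq_ofReal_abs]
      exact ENNReal.ofReal_le_ofReal (abs_trunc_le ht.le _)
    rw [Set.indicator_of_mem (s := {x | t < |u x|}) hxs, enorm_mul,
      ENNReal.ofReal_mul (by positivity), mul_right_comm]
    gcongr
    rwa [Real.enorm_toReal (ne_top_of_le_ne_top (by finiteness) hsource)]
  · have hut : |u x| ≤ t := not_lt.1 hxs
    simp [trunc_of_abs_le hut, trunc_of_abs_le (s := 0) (k := t) (by simpa using ht.le)]

lemma lintegral_dyadicSlice_le (hu : IsEntropySolution p Ω a h f u) (hv : MemTruncW0 p Ω u v)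
    (hp : 1 < p) {α γ c s₀ : ℝ} (hα : 0 < α) (hγ : 0 ≤ γ) (hc : 0 ≤ c)
    (hcoer : ∀ᵐ x ∂volume.restrict Ω, ∀ (s : ℝ) (ξ : E N),
      α / (1 + |s|) ^ (p - 1 + γ) * ‖ξ‖ ^ p ≤ inner ℝ (a x s ξ) ξ)
    (hh : ∀ s, s₀ ≤ s → h s ≤ ENNReal.ofReal (c / s ^ γ)) (ht : 1 ≤ t) (hts : s₀ ≤ t) :
    ∫⁻ x in dyadicSlice u t, ‖v x‖ₑ ^ p ∂volume.restrict Ω ≤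
      ENNReal.ofReal (3 ^ (p - 1 + γ) * c / α) * ENNReal.ofReal (t ^ p) *
        ∫⁻ x in {x | t < |u x|}, ‖f x‖ₑ ∂volume.restrict Ω := by
  have ht0 : 0 < t := by linarith
  have hentropy := hu.entropy_le v hv.isGenGradient t ht0 (fun x => trunc t (u x))
    (hu.trunc_mem t ht0)
    (memLp_top_of_bound (hv t ht0).memLp.1 t
      (Eventually.of_forall fun x => abs_trunc_le ht0.le _)) _
    (by simpa only [trunc_sub_trunc ht0.le] using
      (hv.memW0With_dyadicSlice hp.le ht0).isWeakGradient)
  have henergy := (hu.le_ofReal_integral_flux hv hp hα hγ hcoer ht).trans <|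
    (ENNReal.ofReal_le_ofReal hentropy).trans (hu.ofReal_integral_source_le hγ hc hh ht0 hts)
  have hconst : (α / (3 * t) ^ (p - 1 + γ)) * (3 ^ (p - 1 + γ) * c / α * t ^ p) =
      c / t ^ γ * t := by
    have : 0 < t ^ γ := by positivity
    rw [Real.mul_rpow (by norm_num) ht0.le, Real.rpow_add ht0, Real.rpow_sub_one ht0.ne']
    field_simp
  have hβ : 0 < ENNReal.ofReal (α / (3 * t) ^ (p - 1 + γ)) := by
    rw [ENNReal.ofReal_pos]
    positivity
  rwa [← ENNReal.ofReal_mul (by positivity), ← ENNReal.mul_le_mul_iff_right hβ.ne'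
    ENNReal.ofReal_ne_top, ← mul_assoc, ← ENNReal.ofReal_mul (by positivity), hconst]

end IsEntropySolution

section Dyadic

variable {X : Type*} {u : X → ℝ} {t : ℝ}

lemma exists_mem_dyadicSlice (ht : 0 < t) {x : X} (hx : t < |u x|) :
    ∃ i : ℕ, x ∈ dyadicSlice u (t * 2 ^ i) := by
  have hone : 1 < |u x| / t := (one_lt_div ht).2 hx
  obtain ⟨n, hn, hn'⟩ := exists_mem_Ioc_zpow (zero_lt_one.trans hone) (one_lt_two (α := ℝ))
  have hpos : 0 < n + 1 := (one_lt_zpow_iff_right₀ one_lt_two).1 (hone.trans_le hn')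
  lift n to ℕ using by omega
  rw [lt_div_iff₀' ht, zpow_natCast] at hn
  rw [div_le_iff₀' ht, zpow_add_one₀ two_ne_zero, zpow_natCast] at hn'
  exact ⟨n, hn, by linarith⟩

variable [MeasurableSpace X] {μ : Measure X}

lemma lintegral_le_tsum_dyadicSlice (ht : 0 < t) (g : X → ℝ≥0∞) :
    ∫⁻ x, g x ∂μ ≤ ∫⁻ x in {x | |u x| ≤ t}, g x ∂μ +
      ∑' i : ℕ, ∫⁻ x in dyadicSlice u (t * 2 ^ i), g x ∂μ := by
  have hcover : Set.univ ⊆ {x | |u x| ≤ t} ∪ ⋃ i : ℕ, dyadicSlice u (t * 2 ^ i) := fun x _ =>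
    (le_or_gt |u x| t).imp id fun hx => Set.mem_iUnion.2 (exists_mem_dyadicSlice ht hx)
  calc ∫⁻ x, g x ∂μ
      ≤ ∫⁻ x in {x | |u x| ≤ t} ∪ ⋃ i : ℕ, dyadicSlice u (t * 2 ^ i), g x ∂μ := by
        rw [← setLIntegral_univ]
        exact lintegral_mono_set hcover
    _ ≤ _ := (lintegral_union_le _ _ _).trans (by gcongr; exact lintegral_iUnion_le _ _)

lemma memLp_of_tsum_superlevel [IsFiniteMeasure μ] (hu : AEMeasurable u μ) (ht : 0 < t)
    (hsum : ∀ c : ℝ≥0∞, c ≠ ⊤ → ∑' i : ℕ, c ^ i * μ {x | t * 2 ^ i < |u x|} < ⊤)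
    {q : ℝ≥0∞} (hq : q ≠ ⊤) : MemLp u q μ := by
  refine ⟨hu.aestronglyMeasurable, ?_⟩
  rcases eq_or_ne q 0 with rfl | hq0
  · simp
  rw [eLpNorm_lt_top_iff_lintegral_rpow_enorm_lt_top hq0 hq]
  set r := q.toReal
  have hsublevel : ∀ (s : Set X) (k : ℝ), (∀ x ∈ s, |u x| ≤ k) →
      ∫⁻ x in s, ‖u x‖ₑ ^ r ∂μ ≤ ENNReal.ofReal k ^ r * μ s := fun s k hs => by
    rw [← setLIntegral_const]
    refine setLIntegral_mono measurable_const fun x hx => ?_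
    rw [Real.enorm_eq_ofReal_abs]
    gcongr
    exact hs x hx
  have hslice : ∀ i : ℕ, ∫⁻ x in dyadicSlice u (t * 2 ^ i), ‖u x‖ₑ ^ r ∂μ ≤
      ENNReal.ofReal (2 * t) ^ r * ((2 ^ r) ^ i * μ {x | t * 2 ^ i < |u x|}) := fun i => by
    refine (hsublevel _ (2 * (t * 2 ^ i)) fun x hx => hx.2).trans ?_
    rw [← mul_assoc 2, ENNReal.ofReal_mul (by positivity),
      ENNReal.mul_rpow_of_nonneg _ _ ENNReal.toReal_nonneg, mul_assoc]
    gcongr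
    · rw [ENNReal.ofReal_pow zero_le_two, ENNReal.ofReal_ofNat, ← ENNReal.rpow_natCast_mul,
        ← ENNReal.rpow_mul_natCast, mul_comm]
    · exact fun x hx => hx.1
  refine (lintegral_le_tsum_dyadicSlice (u := u) ht _).trans_lt (ENNReal.add_lt_top.2 ⟨?_, ?_⟩)
  · exact (hsublevel _ t fun x hx => hx).trans_lt (by finiteness)
  · refine (ENNReal.tsum_le_tsum hslice).trans_lt ?_
    rw [ENNReal.tsum_mul_left]
    exact ENNReal.mul_lt_top (by finiteness) (hsum _ (by finiteness))

lemma eLpNorm_indicator_rpow {F : Type*} [NormedAddCommGroup F] {s : Set X}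
    (hs : NullMeasurableSet s μ) {p : ℝ} (hp : 0 < p) (g : X → F) :
    eLpNorm (s.indicator g) (ENNReal.ofReal p) μ ^ p = ∫⁻ x in s, ‖g x‖ₑ ^ p ∂μ := by
  rw [eLpNorm_eq_lintegral_rpow_enorm_toReal (ENNReal.ofReal_pos.2 hp).ne' ENNReal.ofReal_ne_top,
    ENNReal.toReal_ofReal hp.le, one_div, ENNReal.rpow_inv_rpow hp.ne', ← lintegral_indicator₀ hs]
  refine lintegral_congr fun x => ?_
  by_cases hx : x ∈ s <;> simp [hx, hp]

lemma mul_measure_rpow_le_eLpNorm {g : X → ℝ} {q : ℝ} (hq : 0 < q)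
    (hg : AEStronglyMeasurable g μ) {s : Set X} {c : ℝ≥0∞} (hs : ∀ x ∈ s, c ≤ ‖g x‖ₑ) :
    c * μ s ^ q⁻¹ ≤ eLpNorm g (ENNReal.ofReal q) μ := by
  rw [← ENNReal.rpow_le_rpow_iff hq, ENNReal.mul_rpow_of_nonneg _ _ hq.le,
    ENNReal.rpow_inv_rpow hq.ne']
  have hmarkov := mul_meas_ge_le_pow_eLpNorm' μ (ENNReal.ofReal_pos.2 hq).ne'
    ENNReal.ofReal_ne_top hg c
  rw [ENNReal.toReal_ofReal hq.le] at hmarkov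
  exact (mul_le_mul_right (measure_mono hs) _).trans hmarkov

lemma setLIntegral_enorm_le {f : X → ℝ} {r : ℝ} (hr : 1 ≤ r) (hf : AEStronglyMeasurable f μ)
    (s : Set X) :
    ∫⁻ x in s, ‖f x‖ₑ ∂μ ≤
      eLpNorm f (ENNReal.ofReal r) (μ.restrict s) * μ s ^ (1 - r⁻¹) := by
  simpa [eLpNorm_one_eq_lintegral_enorm, ENNReal.toReal_ofReal (zero_le_one.trans hr)] using
    eLpNorm_le_eLpNorm_mul_rpow_measure_univ (ENNReal.one_le_ofReal.2 hr) (hf.restrict (s := s))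

lemma tendsto_eLpNorm_restrict_superlevel {f : X → ℝ} {q : ℝ≥0∞} (hq : q ≠ ⊤) (hf : MemLp f q μ)
    (hu : AEMeasurable u μ) :
    Tendsto (fun t : ℝ => eLpNorm f q (μ.restrict {x | t < |u x|})) atTop (𝓝 0) := by
  refine tendsto_of_seq_tendsto fun k hk => ?_
  have hset : ∀ i, NullMeasurableSet {x | k i < |u x|} μ := fun i =>
    nullMeasurableSet_lt aemeasurable_const hu.abs
  have hlim : TendstoLp q μ (fun i => {x | k i < |u x|}.indicator f) 0 :=
    .of_dominated hq (fun i => hf.1.indicator₀ (hset i)) aestronglyMeasurable_zero hf.norm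
      (fun i => Eventually.of_forall fun x => by
        simpa using norm_indicator_le_norm_self f x)
      (Eventually.of_forall fun x => tendsto_const_nhds.congr' <|
        (hk.eventually_ge_atTop |u x|).mono fun i hi =>
          (Set.indicator_of_notMem (s := {x | k i < |u x|}) (not_lt.2 hi) f).symm)
  refine tendsto_of_tendsto_of_tendsto_of_le_of_le tendsto_const_nhds hlim
    (fun _ => zero_le) fun i => ?_
  calc eLpNorm f q (μ.restrict {x | k i < |u x|})
      = eLpNorm (fun x => {x | k i < |u x|}.indicator f x - 0) q
          (μ.restrict {x | k i < |u x|}) :=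
        eLpNorm_congr_ae <| (ae_restrict_mem₀ (hset i)).mono fun x hx => by
          simp only [Set.indicator_of_mem hx, sub_zero]
    _ ≤ _ := eLpNorm_mono_measure _ Measure.restrict_le_self

lemma tsum_pow_mul_lt_top {m δ : ℕ → ℝ≥0∞} (hm : ∀ i, m i ≠ ⊤)
    (hrec : ∀ i, m (i + 1) ≤ δ i * m i) (hδ : Tendsto δ atTop (𝓝 0)) {c : ℝ≥0∞} (hc : c ≠ ⊤) :
    ∑' i, c ^ i * m i < ⊤ := by
  have hcδ : Tendsto (fun i => c * δ i) atTop (𝓝 0) := by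
    simpa using ENNReal.Tendsto.const_mul (a := c) hδ (Or.inr hc)
  have hratio : ∀ᶠ i in atTop, c ^ (i + 1) * m (i + 1) ≤ (1 / 2 : ℝ≥0) * (c ^ i * m i) := by
    filter_upwards [hcδ.eventually_le_const (u := ((1 / 2 : ℝ≥0) : ℝ≥0∞)) (by simp)] with i hi
    calc c ^ (i + 1) * m (i + 1) ≤ c ^ (i + 1) * (δ i * m i) := by gcongr; exact hrec i
      _ = c * δ i * (c ^ i * m i) := by ring
      _ ≤ _ := by gcongr
  lift m to ℕ → ℝ≥0 using hm
  lift c to ℝ≥0 using hc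
  beta_reduce at hratio
  norm_cast at hratio
  have hsummable : Summable fun i => c ^ i * m i :=
    NNReal.summable_coe.1 <| summable_of_ratio_norm_eventually_le one_half_lt_one <|
      hratio.mono fun i hi => by simpa using NNReal.coe_le_coe.2 hi
  exact_mod_cast (ENNReal.tsum_coe_ne_top_iff_summable.2 hsummable).lt_top

lemma eventually_tsum_superlevel_lt_top [IsFiniteMeasure μ] {κ : ℝ} (hκ : 0 ≤ κ)
    {δ : ℝ → ℝ≥0∞} (hδ : Tendsto δ atTop (𝓝 0))
    (hrec : ∀ᶠ t in atTop, μ {x | 2 * t < |u x|} ^ κ ≤ δ t * μ {x | t < |u x|} ^ κ) :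
    ∀ᶠ t : ℝ in atTop, ∀ c : ℝ≥0∞, c ≠ ⊤ →
      ∑' i : ℕ, c ^ i * μ {x | t * 2 ^ i < |u x|} ^ κ < ⊤ := by
  filter_upwards [eventually_forall_ge_atTop.2 hrec, eventually_gt_atTop 0] with t ht ht0 c hc
  have htlim : Tendsto (fun i : ℕ => t * 2 ^ i) atTop atTop :=
    (tendsto_pow_atTop_atTop_of_one_lt one_lt_two).const_mul_atTop ht0
  refine tsum_pow_mul_lt_top (fun i => by finiteness) (fun i => ?_) (hδ.comp htlim) hc
  rw [pow_succ', mul_left_comm]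
  exact ht _ (le_mul_of_one_le_right ht0.le (one_le_pow₀ one_le_two))

lemma tsum_pow_mul_measure_lt_top [IsFiniteMeasure μ] {s : ℕ → Set X} {κ : ℝ} (hκ : 0 ≤ κ)
    (hκ' : κ ≤ 1) {c : ℝ≥0∞} (hsum : ∑' i, c ^ i * μ (s i) ^ κ < ⊤) :
    ∑' i, c ^ i * μ (s i) < ⊤ := by
  have hle : ∀ i, c ^ i * μ (s i) ≤ μ Set.univ ^ (1 - κ) * (c ^ i * μ (s i) ^ κ) := fun i =>
    calc c ^ i * μ (s i) = c ^ i * (μ (s i) ^ (1 - κ) * μ (s i) ^ κ) := by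
          rw [← ENNReal.rpow_add_of_nonneg _ _ (sub_nonneg.2 hκ') hκ, sub_add_cancel,
            ENNReal.rpow_one]
      _ ≤ c ^ i * (μ Set.univ ^ (1 - κ) * μ (s i) ^ κ) := by
          have : 0 ≤ 1 - κ := sub_nonneg.2 hκ'
          gcongr
          exact Set.subset_univ _
      _ = _ := by ring
  refine (ENNReal.tsum_le_tsum hle).trans_lt ?_
  rw [ENNReal.tsum_mul_left]
  exact ENNReal.mul_lt_top
    (ENNReal.rpow_lt_top_of_nonneg (sub_nonneg.2 hκ') (measure_ne_top _ _)) hsum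

end Dyadic

lemma le_abs_trunc_sub_trunc {t s : ℝ} (ht : 0 ≤ t) (hs : 2 * t ≤ |s|) :
    t ≤ |trunc (2 * t) s - trunc t s| := by
  unfold trunc
  grind

namespace MemTruncW0

variable {u : E N → ℝ} {v : E N → E N} {t : ℝ}

lemma rpow_mul_measure_superlevel_le (h : MemTruncW0 p Ω u v) (hp : 1 ≤ p) (hpN : p < N)
    (ht : 0 < t) :
    ENNReal.ofReal (t ^ p) * volume.restrict Ω {x | 2 * t < |u x|} ^ (1 - p / N) ≤
      SNormLESNormFDerivOfEqConst ℝ (volume : Measure (E N)) p.toNNReal ^ p *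
        ∫⁻ x in dyadicSlice u t, ‖v x‖ₑ ^ p ∂volume.restrict Ω := by
  have hp0 : 0 < p := by linarith
  have hN : 0 < (N : ℝ) := hp0.trans hpN
  obtain ⟨q, hpq⟩ : ∃ q : ℝ, q⁻¹ = p⁻¹ - (N : ℝ)⁻¹ := ⟨_, inv_inv _⟩
  have hq : 0 < q := inv_pos.1 (hpq ▸ sub_pos.2 (inv_strictAnti₀ hp0 hpN))
  have hexp : 1 - p / N = q⁻¹ * p := by rw [hpq]; field_simp
  have hW := h.memW0With_dyadicSlice hp ht
  have hchebyshev : ENNReal.ofReal t * volume.restrict Ω {x | 2 * t < |u x|} ^ q⁻¹ ≤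
      eLpNorm (fun x => trunc (2 * t) (u x) - trunc t (u x)) (ENNReal.ofReal q)
        (volume.restrict Ω) :=
    mul_measure_rpow_le_eLpNorm hq hW.memLp.1 fun x hx => by
      rw [Real.enorm_eq_ofReal_abs]
      exact ENNReal.ofReal_le_ofReal (le_abs_trunc_sub_trunc ht.le (le_of_lt hx))
  calc ENNReal.ofReal (t ^ p) * volume.restrict Ω {x | 2 * t < |u x|} ^ (1 - p / N)
      = (ENNReal.ofReal t * volume.restrict Ω {x | 2 * t < |u x|} ^ q⁻¹) ^ p := by
        rw [ENNReal.mul_rpow_of_nonneg _ _ hp0.le, ENNReal.ofReal_rpow_of_nonneg ht.le hp0.le,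
          ← ENNReal.rpow_mul, hexp]
    _ ≤ _ := by
        rw [← eLpNorm_indicator_rpow (h.nullMeasurableSet_dyadicSlice t) hp0,
          ← ENNReal.mul_rpow_of_nonneg _ _ hp0.le]
        exact ENNReal.rpow_le_rpow
          (hchebyshev.trans (hW.eLpNorm_le_gradient hp (Nat.cast_pos.1 hN) hq hpq)) hp0.le

lemma measure_superlevel_rpow_le (h : MemTruncW0 p Ω u v) (hp : 1 ≤ p) (hpN : p < N)
    (ht : 0 < t) {C : ℝ≥0∞}
    (henergy : ∫⁻ x in dyadicSlice u t, ‖v x‖ₑ ^ p ∂volume.restrict Ω ≤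
      C * ENNReal.ofReal (t ^ p) * volume.restrict Ω {x | t < |u x|} ^ (1 - p / N)) :
    volume.restrict Ω {x | 2 * t < |u x|} ^ (1 - p / N) ≤
      SNormLESNormFDerivOfEqConst ℝ (volume : Measure (E N)) p.toNNReal ^ p * C *
        volume.restrict Ω {x | t < |u x|} ^ (1 - p / N) := by
  rw [← ENNReal.mul_le_mul_iff_right (a := ENNReal.ofReal (t ^ p))
    (ENNReal.ofReal_pos.2 (Real.rpow_pos_of_pos ht p)).ne' ENNReal.ofReal_ne_top]
  refine (h.rpow_mul_measure_superlevel_le hp hpN ht).trans ?_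
  refine (mul_le_mul_right henergy _).trans_eq ?_
  ring

lemma memLp_gradient (h : MemTruncW0 p Ω u v) (hp : 0 < p) {κ : ℝ} (ht : 0 < t)
    (henergy : ∀ τ, t ≤ τ → ∫⁻ x in dyadicSlice u τ, ‖v x‖ₑ ^ p ∂volume.restrict Ω ≤
      ENNReal.ofReal (τ ^ p) * volume.restrict Ω {x | τ < |u x|} ^ κ)
    (hsum : ∑' i : ℕ, ENNReal.ofReal (2 ^ p) ^ i *
      volume.restrict Ω {x | t * 2 ^ i < |u x|} ^ κ < ⊤) :
    MemLp v (ENNReal.ofReal p) (volume.restrict Ω) := by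
  have hp0 : ENNReal.ofReal p ≠ 0 := by simpa using hp
  have hslice : ∀ i : ℕ, ∫⁻ x in dyadicSlice u (t * 2 ^ i), ‖v x‖ₑ ^ p ∂volume.restrict Ω ≤
      ENNReal.ofReal (t ^ p) * (ENNReal.ofReal (2 ^ p) ^ i *
        volume.restrict Ω {x | t * 2 ^ i < |u x|} ^ κ) := fun i => by
    refine (henergy _ (le_mul_of_one_le_right ht.le (one_le_pow₀ one_le_two))).trans_eq ?_
    rw [Real.mul_rpow ht.le (by positivity), ENNReal.ofReal_mul (by positivity),
      ← Real.rpow_pow_comm zero_le_two, ENNReal.ofReal_pow (by positivity), mul_assoc]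
  refine ⟨h.aestronglyMeasurable_gradient, ?_⟩
  rw [eLpNorm_lt_top_iff_lintegral_rpow_enorm_lt_top hp0 ENNReal.ofReal_ne_top,
    ENNReal.toReal_ofReal hp.le]
  refine (lintegral_le_tsum_dyadicSlice (u := u) ht _).trans_lt (ENNReal.add_lt_top.2 ⟨?_, ?_⟩)
  · rw [← eLpNorm_indicator_rpow (nullMeasurableSet_le h.aemeasurable.abs aemeasurable_const) hp]
    exact ENNReal.rpow_lt_top_of_nonneg hp.le (h t ht).memLp_gradient.2.ne
  · refine (ENNReal.tsum_le_tsum hslice).trans_lt ?_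
    rw [ENNReal.tsum_mul_left]
    exact ENNReal.mul_lt_top (by finiteness) hsum

theorem memW0_and_memLp (h : MemTruncW0 p Ω u v) (hp : 1 ≤ p) (hpN : p < N)
    (hΩ : volume Ω ≠ ⊤) {δ : ℝ → ℝ≥0∞} (hδ : Tendsto δ atTop (𝓝 0))
    (henergy : ∀ᶠ t in atTop, ∫⁻ x in dyadicSlice u t, ‖v x‖ₑ ^ p ∂volume.restrict Ω ≤
      δ t * ENNReal.ofReal (t ^ p) * volume.restrict Ω {x | t < |u x|} ^ (1 - p / N)) :
    MemW0 p Ω u ∧ ∀ q : ℝ≥0∞, q < ⊤ → MemLp u q (volume.restrict Ω) := by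
  have : IsFiniteMeasure (volume.restrict Ω) := isFiniteMeasure_restrict.2 hΩ
  have hp0 : 0 < p := by linarith
  have hκ : 0 ≤ 1 - p / N := sub_nonneg.2 (div_le_one_of_le₀ hpN.le N.cast_nonneg)
  have hκ' : 1 - p / N ≤ 1 := sub_le_self _ (by positivity)
  set S := SNormLESNormFDerivOfEqConst ℝ (volume : Measure (E N)) p.toNNReal
  have hSδ : Tendsto (fun t => (S : ℝ≥0∞) ^ p * δ t) atTop (𝓝 0) := by
    simpa using ENNReal.Tendsto.const_mul (a := (S : ℝ≥0∞) ^ p) hδ (Or.inr (by finiteness))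
  have hdecay := eventually_tsum_superlevel_lt_top hκ hSδ <| by
    filter_upwards [henergy, eventually_gt_atTop 0] with t ht ht0
    exact h.measure_superlevel_rpow_le hp hpN ht0 ht
  obtain ⟨t, hsum, ht, hle⟩ := (hdecay.and ((eventually_gt_atTop 0).and
    (eventually_forall_ge_atTop.2 (henergy.and (hδ.eventually_le_const one_pos))))).exists
  have hLq : ∀ q : ℝ≥0∞, q < ⊤ → MemLp u q (volume.restrict Ω) := fun q hq =>
    memLp_of_tsum_superlevel h.aemeasurable ht
      (fun c hc => tsum_pow_mul_measure_lt_top hκ hκ' (hsum c hc)) hq.ne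
  refine ⟨h.memW0 hp (hLq _ ENNReal.ofReal_lt_top) ?_, hLq⟩
  refine h.memLp_gradient hp0 ht (fun τ hτ => (hle τ hτ).1.trans ?_)
    (hsum _ ENNReal.ofReal_ne_top)
  gcongr
  exact mul_le_of_le_one_left zero_le (hle τ hτ).2

end MemTruncW0

end EntropyDirichlet

open EntropyDirichlet in
theorem lemma5p6_general {N : ℕ} {p : ℝ} {Ω : Set (E N)} (hp : 1 < p) (hpN : p < N)
    (hΩ : IsOpen Ω) (hΩfin : volume Ω ≠ ⊤)
    {a : E N → ℝ → E N → E N} {α γ : ℝ} (hα : 0 < α) (hγ : 0 ≤ γ)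
    (hcoer : ∀ᵐ x ∂volume.restrict Ω, ∀ (s : ℝ) (ξ : E N),
      α / (1 + |s|) ^ (p - 1 + γ) * ‖ξ‖ ^ p ≤ inner ℝ (a x s ξ) ξ)
    {h : ℝ → ℝ≥0∞} {c s₀ : ℝ} (hc : 0 ≤ c)
    (hh : ∀ s, s₀ ≤ s → h s ≤ ENNReal.ofReal (c / s ^ γ))
    {f : E N → ℝ} (hf : MemLp f (ENNReal.ofReal (N / p)) (volume.restrict Ω))
    {u : E N → ℝ} (hu : IsEntropySolution p Ω a h f u) :
    MemW0 p Ω u ∧ ∀ q : ℝ≥0∞, q < ⊤ → MemLp u q (volume.restrict Ω) := by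
  have hNp : 1 ≤ N / p := (one_le_div (by linarith)).2 hpN.le
  obtain ⟨v, hv⟩ := exists_memTruncW0 hp.le hΩ hu.trunc_mem
  have hδ : Tendsto (fun t => ENNReal.ofReal (3 ^ (p - 1 + γ) * c / α) *
      eLpNorm f (ENNReal.ofReal (N / p)) ((volume.restrict Ω).restrict {x | t < |u x|}))
      atTop (𝓝 0) := by
    simpa using ENNReal.Tendsto.const_mul
      (tendsto_eLpNorm_restrict_superlevel ENNReal.ofReal_ne_top hf hu.aemeasurable)
      (Or.inr ENNReal.ofReal_ne_top)
  refine hv.memW0_and_memLp hp.le hpN hΩfin hδ ?_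
  filter_upwards [eventually_ge_atTop 1, eventually_ge_atTop s₀] with t ht hts
  refine (hu.lintegral_dyadicSlice_le hv hp hα hγ hc hcoer hh ht hts).trans ?_
  have hholder := setLIntegral_enorm_le hNp hf.1 {x | t < |u x|}
  rw [inv_div] at hholder
  exact (mul_le_mul_right hholder _).trans_eq (by ring)

theorem lemma5p6 {N : ℕ} (hN : 2 ≤ N) (p : ℝ) (hp1 : 1 < p) (hpN : p < N)
    (Ω : Set (EntropyDirichlet.E N)) (hΩ : IsOpen Ω) (hΩb : Bornology.IsBounded Ω)
    (a : EntropyDirichlet.E N → ℝ → EntropyDirichlet.E N → EntropyDirichlet.E N)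
    (ha : EntropyDirichlet.IsCaratheodory Ω a)
    (b : ℝ → ℝ) (hb : Continuous b) (hbb : ∃ B : ℝ, ∀ s, |b s| ≤ B)
    (hcoer : ∀ᵐ x ∂volume.restrict Ω, ∀ (s : ℝ) (ξ : EntropyDirichlet.E N),
      b s * ‖ξ‖ ^ p ≤ inner ℝ (a x s ξ) ξ)
    (α θ γ₂ : ℝ) (hα : 0 < α) (hγ₂ : 0 ≤ γ₂) (hθ : θ = 1 + γ₂ / (p - 1))
    (hbθ : ∀ s, α / (1 + |s|) ^ (θ * (p - 1)) ≤ b s)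
    (h : ℝ → ℝ≥0∞) (hcont : ContinuousOn h (Set.Ioi 0)) (hfin : ∀ s, 0 < s → h s ≠ ⊤)
    (c₂ s₂ : ℝ) (hc₂ : 0 < c₂) (hs₂ : 0 < s₂)
    (hh : ∀ s, s₂ ≤ s → h s ≤ ENNReal.ofReal (c₂ / s ^ γ₂))
    (f : EntropyDirichlet.E N → ℝ) (hf0 : ∀ᵐ x ∂volume.restrict Ω, 0 ≤ f x)
    (hf : MemLp f (ENNReal.ofReal (N / p)) (volume.restrict Ω))
    (u : EntropyDirichlet.E N → ℝ)
    (hu : EntropyDirichlet.IsEntropySolution p Ω a h f u) :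
    EntropyDirichlet.MemW0 p Ω u ∧
      ∀ q : ℝ≥0∞, q < ⊤ → MemLp u q (volume.restrict Ω) := by
  have hexp : θ * (p - 1) = p - 1 + γ₂ := by
    have : p - 1 ≠ 0 := by linarith
    rw [hθ]
    field_simp
  refine lemma5p6_general hp1 hpN hΩ hΩb.measure_lt_top.ne hα hγ₂ ?_ hc₂.le hh hf hu
  filter_upwards [hcoer] with x hx s ξ
  exact (mul_le_mul_of_nonneg_right (hexp ▸ hbθ s) (by positivity)).trans (hx s ξ)
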